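/- For a complex polynomial $p$ let $\Lambda_p=\{z\in\mathbb{C}:|p(z)|<1\}$, and let $m$ be Lebesgue measure on $\mathbb{C}$. For a compact set $K\subset\mathbb{C}$ and an integer $n\ge 1$ let $A_n(K)$ be the infimum of $m(\Lambda_p)$ over all monic polynomials $p(z)=\prod_{i=1}^n(z-z_i)$ with $z_1,\dots,z_n\in K$, and put $\mu(K)=\inf_{n\ge1}A_n(K)$. Let $\mathrm{cap}(K)=\sup_\nu \exp\left(\iint\log|z-w|\,d\nu(z)\,d\nu(w)\right)$ be the logarithmic capacity of $K$, where the supremum is over the Borel probability measures $\nu$ on $K$. Let $t\in(0,1)$. (a) For all real $j\ge2$ and $\varepsilon>0$, the set $B_{j,\varepsilon}=[j,j+\varepsilon]\cup[-j-\varepsilon,-j]\subset\mathbb{R}\subset\mathbb{C}$ has capacity $\mathrm{cap}(B_{j,\varepsilon})=\frac12\sqrt{(2j+\varepsilon)\varepsilon}$. For every real $j\ge2$ there is $\varepsilon=\varepsilon(t,j)>0$ such that $\mathrm{cap}(B_{j,\varepsilon})=t$, $A_n(B_{j,\varepsilon})\le\frac{2\pi}{j}$ for all $n\ge2$, and hence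 $\mu(B_{j,\varepsilon})\le\frac{2\pi}{j}$. (b) The closed disc $D_t=\{z\in\mathbb{C}:|z|\le t\}$ has $\mathrm{cap}(D_t)=t$, and there is $r=r(t)>0$ such that $\mu(D_t)\ge\pi r^2$. (c) There are compact sets $K_1,K_2\subset\mathbb{C}$ with $\mathrm{cap}(K_1)=\mathrm{cap}(K_2)=t$ and $\mu(K_1)\ne\mu(K_2)$. Consequently $\mu(K)$ is not uniquely determined by $\mathrm{cap}(K)$: it is not true that $\mu(K_1)=\mu(K_2)$ for all compact $K_1,K_2\subset\mathbb{C}$ with $\mathrm{cap}(K_1)=\mathrm{cap}(K_2)$. -/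

import Mathlib

open MeasureTheory Set
open scoped ENNReal Polynomial

noncomputable section

/-- The (open) unit lemniscate `{z ∈ ℂ : |p(z)| < 1}` of a complex polynomial. -/
def unitLemniscate (p : ℂ[X]) : Set ℂ := {z : ℂ | ‖p.eval z‖ < 1}

/-- The monic polynomials `∏_{i=1}^{n} (X - z_i)` of degree `n` all of whose zeros lie in `K`. -/
def monicZerosIn (n : ℕ) (K : Set ℂ) : Set ℂ[X] :=
  {p | ∃ z : Fin n → ℂ, (∀ i, z i ∈ K) ∧ p = ∏ i, (Polynomial.X - Polynomial.C (z i))}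

/-- `A_n(K)`: the infimum of the areas of the unit lemniscates of the monic polynomials of degree
`n` with all zeros in `K`. -/
def minLemniscateArea (n : ℕ) (K : Set ℂ) : ℝ≥0∞ :=
  ⨅ p ∈ monicZerosIn n K, volume (unitLemniscate p)

/-- `μ(K) = inf_{n ≥ 1} A_n(K)`. -/
def infLemniscateArea (K : Set ℂ) : ℝ≥0∞ :=
  ⨅ (n : ℕ) (_ : 1 ≤ n), minLemniscateArea n K

/-- The logarithmic energy `I(ν) = ∬ log |z - w| dν(w) dν(z)`, with values in `[-∞, ∞]`, as the
integral of the positive part of the kernel minus that of the negative part. The kernel is `-∞` on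
the diagonal. For a finite measure of bounded support the first integral is finite. -/
def logEnergy (ν : Measure ℂ) : EReal :=
  ((∫⁻ z, ∫⁻ w, (ENNReal.log ‖z - w‖ₑ).toENNReal ∂ν ∂ν : ℝ≥0∞) : EReal)
    - ((∫⁻ z, ∫⁻ w, (-ENNReal.log ‖z - w‖ₑ).toENNReal ∂ν ∂ν : ℝ≥0∞) : EReal)

/-- The logarithmic capacity `cap(K) = sup_ν exp(I(ν))` of a compact set `K ⊆ ℂ`, the supremum
being over the Borel probability measures `ν` carried by `K`. -/
def logCapacity (K : Set ℂ) : ℝ≥0∞ :=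
  ⨆ (ν : Measure ℂ) (_ : IsProbabilityMeasure ν) (_ : ν Kᶜ = 0), EReal.exp (logEnergy ν)

/-- The set `[j, j + ε] ∪ [-j - ε, -j]` on the real line, as a subset of `ℂ`. -/
def twoIntervals (j ε : ℝ) : Set ℂ :=
  (fun x : ℝ => (x : ℂ)) '' (Icc j (j + ε) ∪ Icc (-j - ε) (-j))

end

/-!
The capacities are computed from both sides. For the upper bound, let `P k` be monic polynomials of
degree `k` with `|P k| ≤ C ρ ^ k` on a bounded set `K`. The Vandermonde determinant of `n` points of
`K` is also the determinant of the values of `P 0, …, P (n - 1)`, so it is at most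
`n ^ (n / 2) C ^ n ρ ^ (n (n - 1) / 2)` by a Hadamard-type inequality. Taking logarithms and
integrating over `n` independent points with law `ν`, one gets `I(ν) ≤ log ρ` as `n → ∞`
(`logEnergy_le_log_of_monic_bound`). For the lower bound, a measure without atoms whose logarithmic
potential is a constant `c` on a set carrying it has energy `c` (`logEnergy_eq_of_potential_eq`).

For the disc, `P k = z ^ k` and the uniform distribution on the boundary circle do. The two intervals
are the preimage under `z ↦ z ^ 2` of the interval `[j ^ 2, (j + ε) ^ 2]` of capacity
`s = (2 j + ε) ε / 4`; Chebyshev polynomials in `z ^ 2`, multiplied by `z` in odd degrees, and the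
symmetric pull-back of the arcsine law do, with `ρ = √s`. The potential of this law is computed from
`|2 cos φ - 2 cos θ| = |u - a| |u - a⁻¹|`, where `u = exp (iθ)` and `a = exp (iφ)`, and the mean of
`log |u - a|` over the unit circle.

Areas: with half of the zeros (up to one) at `j` and the others at `-j`, every point of the lemniscate
is within `1 / √j` of the nearer zero, which gives the area bound `2 π / j`. If all zeros lie in the
disc of radius `t < 1`, then `log |p|` has mean `n log ρ` over the circle of radius `ρ = (1 + t) / 2`,
so `|p| ≤ ρ ^ n` at one of its points; since that point is far from the zeros, `|p| < 1` on a disc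
around it whose radius depends on `t` only. Letting `j → ∞` at fixed capacity separates the two
families.
-/

/-! ### A determinant bound -/

open scoped ComplexOrder in
/-- A weak form of Hadamard's inequality: apply the inequality of arithmetic and geometric means
to the eigenvalues of `M * Mᴴ`, whose trace is at most `n ^ 2`. -/
theorem sq_norm_det_le_of_norm_le_one {n : ℕ} (M : Matrix (Fin n) (Fin n) ℂ)
    (hM : ∀ i j, ‖M i j‖ ≤ 1) : ‖M.det‖ ^ 2 ≤ (n : ℝ) ^ n := by
  rcases Nat.eq_zero_or_pos n with rfl | hn
  · simp
  have hn' : (0 : ℝ) < n := Nat.cast_pos.2 hn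
  have hpsd : (M * M.conjTranspose).PosSemidef := Matrix.posSemidef_self_mul_conjTranspose M
  set ev := hpsd.isHermitian.eigenvalues with hev
  have h0 : ∀ i, 0 ≤ ev i := hpsd.eigenvalues_nonneg
  have hdet : ‖M.det‖ ^ 2 = ∏ i, ev i := by
    have h := hpsd.isHermitian.det_eq_prod_eigenvalues
    rw [Matrix.det_mul, Matrix.det_conjTranspose, Complex.star_def, Complex.mul_conj,
      Complex.normSq_eq_norm_sq] at h
    refine Complex.ofReal_injective ?_
    push_cast at h ⊢
    exact h
  have htr : ∑ i, ev i ≤ (n : ℝ) * n := by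
    have h := hpsd.isHermitian.trace_eq_sum_eigenvalues
    have h2 : (M * M.conjTranspose).trace = ((∑ i, ∑ j, ‖M i j‖ ^ 2 : ℝ) : ℂ) := by
      simp [Matrix.trace, Matrix.mul_apply, Complex.mul_conj, Complex.normSq_eq_norm_sq]
    rw [h2] at h
    have h3 : (∑ i, ∑ j, ‖M i j‖ ^ 2 : ℝ) = ∑ i, ev i := by
      refine Complex.ofReal_injective (h.trans ?_)
      rw [Complex.ofReal_sum]
      rfl
    rw [← h3]
    calc (∑ i, ∑ j, ‖M i j‖ ^ 2 : ℝ) ≤ ∑ _i : Fin n, ∑ _j : Fin n, (1 : ℝ) :=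
          Finset.sum_le_sum fun i _ => Finset.sum_le_sum fun j _ =>
            pow_le_one₀ (norm_nonneg _) (hM i j)
      _ = n * n := by simp
  have hamgm := Real.geom_mean_le_arith_mean_weighted Finset.univ (fun _ : Fin n => (n : ℝ)⁻¹) ev
    (fun _ _ => by positivity) (by simp [hn'.ne']) (fun i _ => h0 i)
  rw [Real.finsetProd_rpow _ _ (fun i _ => h0 i), ← Finset.mul_sum] at hamgm
  have hle : (∏ i, ev i) ^ (n : ℝ)⁻¹ ≤ n := by
    refine hamgm.trans ?_
    rw [inv_mul_le_iff₀ hn']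
    exact htr
  have hp : 0 ≤ ∏ i, ev i := Finset.prod_nonneg fun i _ => h0 i
  calc ‖M.det‖ ^ 2 = ((∏ i, ev i) ^ (n : ℝ)⁻¹) ^ n := by
        rw [hdet, Real.rpow_inv_natCast_pow hp hn.ne']
    _ ≤ (n : ℝ) ^ n := pow_le_pow_left₀ (Real.rpow_nonneg hp _) hle n

/-- A Vandermonde determinant is unchanged when the monomials are replaced by monic polynomials
of the same degrees, so bounds for these polynomials bound the product of the mutual distances of
points. -/
theorem log_norm_det_vandermonde_le {n : ℕ} (v : Fin n → ℂ) (P : ℕ → ℂ[X])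
    (hmonic : ∀ k, (P k).Monic) (hdeg : ∀ k, (P k).natDegree = k) {C ρ : ℝ} (hC : 0 < C)
    (hρ : 0 < ρ) (hP : ∀ k i, ‖(P k).eval (v i)‖ ≤ C * ρ ^ k)
    (hv : (Matrix.vandermonde v).det ≠ 0) :
    Real.log ‖(Matrix.vandermonde v).det‖ ≤
      n * Real.log n / 2 + n * Real.log C + (∑ k : Fin n, (k : ℝ)) * Real.log ρ := by
  have hpos : ∀ k : ℕ, 0 < C * ρ ^ k := fun k => by positivity
  have hdet := Matrix.det_eval_matrixOfPolynomials_eq_det_vandermonde v (fun j : Fin n => P j)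
    (fun i => hdeg i) (fun i => hmonic i)
  set N : Matrix (Fin n) (Fin n) ℂ :=
    Matrix.of fun i j => (((C * ρ ^ (j : ℕ) : ℝ) : ℂ))⁻¹ * (P j).eval (v i) with hN
  have hfac : (Matrix.vandermonde v).det = (∏ j : Fin n, ((C * ρ ^ (j : ℕ) : ℝ) : ℂ)) * N.det := by
    rw [hdet, ← Matrix.det_mul_row]
    congr 1
    ext i j
    have : ((C * ρ ^ (j : ℕ) : ℝ) : ℂ) ≠ 0 := by exact_mod_cast (hpos j).ne'
    simp only [hN, Matrix.of_apply]
    rw [mul_inv_cancel_left₀ this]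
  have hN1 : ‖N.det‖ ^ 2 ≤ (n : ℝ) ^ n := by
    apply sq_norm_det_le_of_norm_le_one
    intro i j
    simp only [hN, Matrix.of_apply, norm_mul, norm_inv, Complex.norm_real, Real.norm_eq_abs]
    rw [← abs_mul, abs_of_pos (hpos j), inv_mul_le_iff₀ (hpos j), mul_one]
    exact hP j i
  have hN0 : N.det ≠ 0 := fun h => hv (by rw [hfac, h, mul_zero])
  have hNlog : Real.log ‖N.det‖ ≤ n * Real.log n / 2 := by
    have := Real.log_le_log (by positivity) hN1
    rw [Real.log_pow, Real.log_pow] at this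
    push_cast at this
    linarith
  have hprod : Real.log ‖∏ j : Fin n, ((C * ρ ^ (j : ℕ) : ℝ) : ℂ)‖ =
      n * Real.log C + (∑ k : Fin n, (k : ℝ)) * Real.log ρ := by
    rw [norm_prod, Real.log_prod (fun j _ => by
      rw [Complex.norm_real]; exact norm_ne_zero_iff.2 (hpos j).ne')]
    simp_rw [Complex.norm_real, Real.norm_eq_abs, abs_of_pos (hpos _)]
    rw [Finset.sum_congr rfl fun j _ => Real.log_mul hC.ne' (pow_pos hρ _).ne']
    simp [Finset.sum_add_distrib, Finset.sum_mul]
  rw [hfac, norm_mul, Real.log_mul _ (norm_ne_zero_iff.2 hN0), hprod]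
  · linarith
  · rw [norm_ne_zero_iff, Finset.prod_ne_zero_iff]
    intro j _
    exact_mod_cast (hpos j).ne'

/-! ### The logarithmic energy as a Bochner integral -/

/-- At `x = 0` both sides vanish: `ENNReal.log 0 = ⊥` has positive part `0`, and `Real.log 0 = 0`. -/
theorem toENNReal_log_enorm (x : ℂ) :
    (ENNReal.log ‖x‖ₑ).toENNReal = ENNReal.ofReal (Real.log ‖x‖) := by
  rcases eq_or_ne x 0 with rfl | hx
  · simp
  · rw [← ofReal_norm, ENNReal.log_ofReal_of_pos (norm_pos_iff.2 hx)]
    simp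

theorem toENNReal_neg_log_enorm {x : ℂ} (hx : x ≠ 0) :
    (-ENNReal.log ‖x‖ₑ).toENNReal = ENNReal.ofReal (-Real.log ‖x‖) := by
  rw [← ofReal_norm, ENNReal.log_ofReal_of_pos (norm_pos_iff.2 hx), ← EReal.coe_neg]
  simp

theorem measurable_log_norm_sub : Measurable fun p : ℂ × ℂ => Real.log ‖p.1 - p.2‖ := by
  fun_prop

theorem measurable_toENNReal_neg_log_enorm_sub :
    Measurable fun p : ℂ × ℂ => (-ENNReal.log ‖p.1 - p.2‖ₑ).toENNReal := by
  have h : Measurable fun p : ℂ × ℂ => -ENNReal.log ‖p.1 - p.2‖ₑ := by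
    refine Measurable.neg ?_
    exact ENNReal.measurable_log.comp (by fun_prop)
  exact h.ereal_toENNReal

theorem logEnergy_eq_lintegral_prod (ν : Measure ℂ) [SFinite ν] :
    logEnergy ν =
      ((∫⁻ p, ENNReal.ofReal (Real.log ‖p.1 - p.2‖) ∂ν.prod ν : ℝ≥0∞) : EReal)
      - ((∫⁻ p, (-ENNReal.log ‖p.1 - p.2‖ₑ).toENNReal ∂ν.prod ν : ℝ≥0∞) : EReal) := by
  rw [lintegral_prod _ measurable_log_norm_sub.ennreal_ofReal.aemeasurable,
    lintegral_prod _ measurable_toENNReal_neg_log_enorm_sub.aemeasurable]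
  simp only [logEnergy, toENNReal_log_enorm]

/-- When the diagonal is a null set, the value `Real.log 0 = 0` on it is harmless. -/
theorem logEnergy_eq_integral {ν : Measure ℂ} [SFinite ν]
    (hd : ∀ᵐ p ∂ν.prod ν, p.1 ≠ p.2)
    (hi : Integrable (fun p : ℂ × ℂ => Real.log ‖p.1 - p.2‖) (ν.prod ν)) :
    logEnergy ν = ((∫ p, Real.log ‖p.1 - p.2‖ ∂ν.prod ν : ℝ) : EReal) := by
  have hneg : ∫⁻ p, (-ENNReal.log ‖p.1 - p.2‖ₑ).toENNReal ∂ν.prod ν =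
      ∫⁻ p, ENNReal.ofReal (-Real.log ‖p.1 - p.2‖) ∂ν.prod ν := by
    refine lintegral_congr_ae ?_
    filter_upwards [hd] with p hp
    exact toENNReal_neg_log_enorm (sub_ne_zero.2 hp)
  have h1 := hi.lintegral_lt_top.ne
  have h2 := hi.neg.lintegral_lt_top.ne
  simp only [Pi.neg_apply] at h2
  rw [logEnergy_eq_lintegral_prod, hneg, integral_eq_lintegral_pos_part_sub_lintegral_neg_part hi,
    EReal.coe_sub, EReal.coe_ennreal_toReal h1, EReal.coe_ennreal_toReal h2]

theorem log_norm_sub_le_two_mul {K : Set ℂ} {R : ℝ} (hR : ∀ z ∈ K, ‖z‖ ≤ R) {z w : ℂ}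
    (hz : z ∈ K) (hw : w ∈ K) : Real.log ‖z - w‖ ≤ 2 * R := by
  have h : ‖z - w‖ ≤ 2 * R := (norm_sub_le z w).trans (by linarith [hR z hz, hR w hw])
  exact (Real.log_le_self (norm_nonneg _)).trans h

/-- A measure on a bounded set either has energy `-∞` or an integrable logarithmic kernel. -/
theorem logEnergy_eq_bot_or {ν : Measure ℂ} [IsFiniteMeasure ν] {K : Set ℂ} {R : ℝ}
    (hR : ∀ z ∈ K, ‖z‖ ≤ R) (hK : ν Kᶜ = 0) :
    logEnergy ν = ⊥ ∨ ((∀ᵐ p ∂ν.prod ν, p.1 ≠ p.2) ∧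
      Integrable (fun p : ℂ × ℂ => Real.log ‖p.1 - p.2‖) (ν.prod ν)) := by
  by_cases hN : ∫⁻ p, (-ENNReal.log ‖p.1 - p.2‖ₑ).toENNReal ∂ν.prod ν = ⊤
  · left
    rw [logEnergy_eq_lintegral_prod, hN]
    simp [sub_eq_add_neg]
  right
  have hKae : ∀ᵐ z ∂ν, z ∈ K := hK
  have hmem : ∀ᵐ p ∂ν.prod ν, p.1 ∈ K ∧ p.2 ∈ K :=
    (Measure.quasiMeasurePreserving_fst.ae hKae).and (Measure.quasiMeasurePreserving_snd.ae hKae)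
  have hd : ∀ᵐ p ∂ν.prod ν, p.1 ≠ p.2 := by
    filter_upwards [ae_lt_top measurable_toENNReal_neg_log_enorm_sub hN] with p hp h
    simp [h] at hp
  refine ⟨hd, measurable_log_norm_sub.aestronglyMeasurable, ?_⟩
  rw [hasFiniteIntegral_iff_norm]
  calc ∫⁻ p, ENNReal.ofReal ‖Real.log ‖p.1 - p.2‖‖ ∂ν.prod ν
      ≤ ∫⁻ p, (-ENNReal.log ‖p.1 - p.2‖ₑ).toENNReal + ENNReal.ofReal (2 * R) ∂ν.prod ν := by
        refine lintegral_mono_ae ?_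
        filter_upwards [hd, hmem] with p hp hp2
        rw [toENNReal_neg_log_enorm (sub_ne_zero.2 hp), Real.norm_eq_abs]
        rcases le_total 0 (Real.log ‖p.1 - p.2‖) with h | h
        · rw [abs_of_nonneg h]
          exact le_add_left (ENNReal.ofReal_le_ofReal (log_norm_sub_le_two_mul hR hp2.1 hp2.2))
        · rw [abs_of_nonpos h]
          exact le_add_right le_rfl
    _ < ⊤ := by
        rw [lintegral_add_right _ measurable_const]
        exact ENNReal.add_lt_top.2 ⟨lt_top_iff_ne_top.2 hN, by
          rw [lintegral_const]; exact ENNReal.mul_lt_top ENNReal.ofReal_lt_top (measure_lt_top _ _)⟩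

/-- A measure whose logarithmic potential is constant on a set carrying it has that constant as
its energy. -/
theorem logEnergy_eq_of_potential_eq {ν : Measure ℂ} [IsProbabilityMeasure ν] {K : Set ℂ} {R c : ℝ}
    (hR : ∀ z ∈ K, ‖z‖ ≤ R) (hK : ν Kᶜ = 0) (hatom : ∀ z ∈ K, ν {z} = 0)
    (hint : ∀ z ∈ K, Integrable (fun w => Real.log ‖z - w‖) ν)
    (hpot : ∀ z ∈ K, ∫ w, Real.log ‖z - w‖ ∂ν = c) :
    logEnergy ν = (c : EReal) := by
  have hKae : ∀ᵐ z ∂ν, z ∈ K := hK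
  have hd : ∀ᵐ p ∂ν.prod ν, p.1 ≠ p.2 := by
    refine (Measure.ae_prod_iff_ae_ae ?_).2 ?_
    · exact (measurableSet_eq_fun measurable_fst measurable_snd).compl
    filter_upwards [hKae] with z hz
    have h := hatom z hz
    rw [ae_iff]
    convert h using 2
    ext w
    simp [eq_comm]
  have hi : Integrable (fun p : ℂ × ℂ => Real.log ‖p.1 - p.2‖) (ν.prod ν) := by
    rw [integrable_prod_iff measurable_log_norm_sub.aestronglyMeasurable]
    refine ⟨by filter_upwards [hKae] with z hz using hint z hz, ?_⟩
    refine Integrable.mono' (integrable_const (4 * |R| - c))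
      measurable_log_norm_sub.aestronglyMeasurable.norm.integral_prod_right' ?_
    filter_upwards [hKae] with z hz
    rw [Real.norm_of_nonneg (integral_nonneg fun _ => norm_nonneg _)]
    -- `|f| = 2 f⁺ - f`, where `f⁺ ≤ 2 |R|` on the carrier and `f` has integral `c`.
    have : ∫ w, ‖Real.log ‖z - w‖‖ ∂ν ≤ ∫ w, (4 * |R| - Real.log ‖z - w‖) ∂ν := by
      refine integral_mono_ae (hint z hz).norm ((integrable_const _).sub (hint z hz)) ?_
      filter_upwards [hKae] with w hw
      have h1 := log_norm_sub_le_two_mul hR hz hw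
      have h2 := le_abs_self R
      have h3 := abs_nonneg R
      rw [Real.norm_eq_abs, abs_le]
      constructor <;> linarith
    rw [integral_sub (integrable_const _) (hint z hz), hpot z hz] at this
    simpa using this
  rw [logEnergy_eq_integral hd hi, integral_prod _ hi]
  congr 1
  calc ∫ z, ∫ w, Real.log ‖z - w‖ ∂ν ∂ν = ∫ _z, c ∂ν := by
        refine integral_congr_ae ?_
        filter_upwards [hKae] with z hz using hpot z hz
    _ = c := by simp

/-! ### Upper bounds for the capacity -/

theorem measurePreserving_eval_pair {n : ℕ} (ν : Measure ℂ) [IsProbabilityMeasure ν] {i j : Fin n}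
    (hij : i ≠ j) :
    MeasurePreserving (fun z : Fin n → ℂ => (z i, z j)) (Measure.pi fun _ => ν) (ν.prod ν) := by
  refine ⟨by fun_prop, ?_⟩
  have hind := (ProbabilityTheory.iIndepFun_pi (μ := fun _ : Fin n => ν)
    (X := fun _ => id) (fun _ => aemeasurable_id)).indepFun hij
  have h := (ProbabilityTheory.indepFun_iff_map_prod_eq_prod_map_map
    (measurable_pi_apply i).aemeasurable (measurable_pi_apply j).aemeasurable).1 hind
  have hi := (measurePreserving_eval (fun _ : Fin n => ν) i).map_eq
  have hj := (measurePreserving_eval (fun _ : Fin n => ν) j).map_eq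
  exact h.trans (congrArg₂ Measure.prod hi hj)

theorem sum_card_Ioi_fin (n : ℕ) :
    ∑ i : Fin n, ((Finset.Ioi i).card : ℝ) = ∑ i : Fin n, (i : ℝ) := by
  rw [← Equiv.sum_comp Fin.revPerm]
  refine Finset.sum_congr rfl fun i _ => ?_
  have : (Finset.Ioi (Fin.rev i)).card = (i : ℕ) := by
    rw [Fin.card_Ioi, Fin.val_rev]
    omega
  simp [this]

/-- Fekete's argument: the expected logarithm of the Vandermonde determinant of `n` independent
points with law `ν` is `n (n - 1) / 2` times the energy, while monic polynomials `P k` of degree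
`k` with `|P k| ≤ C ρ ^ k` on the carrier bound this determinant. -/
theorem energy_integral_le {ν : Measure ℂ} [IsProbabilityMeasure ν] {K : Set ℂ} (hK : ν Kᶜ = 0)
    (hd : ∀ᵐ p ∂ν.prod ν, p.1 ≠ p.2)
    (hi : Integrable (fun p : ℂ × ℂ => Real.log ‖p.1 - p.2‖) (ν.prod ν))
    (P : ℕ → ℂ[X]) (hmonic : ∀ k, (P k).Monic) (hdeg : ∀ k, (P k).natDegree = k) {C ρ : ℝ}
    (hC : 0 < C) (hρ : 0 < ρ) (hP : ∀ k, ∀ z ∈ K, ‖(P k).eval z‖ ≤ C * ρ ^ k) (n : ℕ) :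
    (∑ k : Fin n, (k : ℝ)) * ∫ p, Real.log ‖p.1 - p.2‖ ∂ν.prod ν ≤
      n * Real.log n / 2 + n * Real.log C + (∑ k : Fin n, (k : ℝ)) * Real.log ρ := by
  set π : Measure (Fin n → ℂ) := Measure.pi fun _ => ν with hπ
  have hpair : ∀ i : Fin n, ∀ j ∈ Finset.Ioi i,
      MeasurePreserving (fun z : Fin n → ℂ => (z j, z i)) π (ν.prod ν) := fun i j hj =>
    measurePreserving_eval_pair ν (Finset.mem_Ioi.1 hj).ne'
  have hint : ∀ i : Fin n, ∀ j ∈ Finset.Ioi i,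
      Integrable (fun z : Fin n → ℂ => Real.log ‖z j - z i‖) π := fun i j hj =>
    (hpair i j hj).integrable_comp_of_integrable hi
  have hval : ∀ i : Fin n, ∀ j ∈ Finset.Ioi i,
      ∫ z, Real.log ‖z j - z i‖ ∂π = ∫ p, Real.log ‖p.1 - p.2‖ ∂ν.prod ν := fun i j hj => by
    rw [← (hpair i j hj).map_eq, integral_map (hpair i j hj).measurable.aemeasurable
      measurable_log_norm_sub.aestronglyMeasurable]
  have hKae : ∀ᵐ z ∂ν, z ∈ K := hK
  have hmem : ∀ᵐ z ∂π, ∀ i, z i ∈ K := by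
    rw [ae_all_iff]
    intro i
    exact (measurePreserving_eval (fun _ : Fin n => ν) i).quasiMeasurePreserving.ae hKae
  have hdist : ∀ᵐ z ∂π, ∀ i : Fin n, ∀ j ∈ Finset.Ioi i, z j ≠ z i := by
    rw [ae_all_iff]
    intro i
    rw [Filter.eventually_all_finset]
    intro j hj
    exact (hpair i j hj).quasiMeasurePreserving.ae hd
  have hle : ∫ z, ∑ i : Fin n, ∑ j ∈ Finset.Ioi i, Real.log ‖z j - z i‖ ∂π ≤
      ∫ _z, (n * Real.log n / 2 + n * Real.log C + (∑ k : Fin n, (k : ℝ)) * Real.log ρ) ∂π := by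
    refine integral_mono_ae (integrable_finsetSum _ fun i _ => integrable_finsetSum _ (hint i))
      (integrable_const _) ?_
    filter_upwards [hmem, hdist] with z hz1 hz2
    have hV : (Matrix.vandermonde z).det ≠ 0 := by
      rw [Matrix.det_vandermonde]
      exact Finset.prod_ne_zero_iff.2 fun i _ => Finset.prod_ne_zero_iff.2 fun j hj =>
        sub_ne_zero.2 (hz2 i j hj)
    have hlog : Real.log ‖(Matrix.vandermonde z).det‖ =
        ∑ i : Fin n, ∑ j ∈ Finset.Ioi i, Real.log ‖z j - z i‖ := by
      have h0 : ∀ i : Fin n, ∀ j ∈ Finset.Ioi i, ‖z j - z i‖ ≠ 0 := fun i j hj =>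
        norm_ne_zero_iff.2 (sub_ne_zero.2 (hz2 i j hj))
      rw [Matrix.det_vandermonde]
      simp_rw [norm_prod]
      rw [Real.log_prod fun i _ => Finset.prod_ne_zero_iff.2 (h0 i)]
      exact Finset.sum_congr rfl fun i _ => Real.log_prod (h0 i)
    show ∑ i : Fin n, ∑ j ∈ Finset.Ioi i, Real.log ‖z j - z i‖ ≤ _
    rw [← hlog]
    exact log_norm_det_vandermonde_le z P hmonic hdeg hC hρ (fun k i => hP k _ (hz1 i)) hV
  rw [integral_finsetSum _ fun i _ => integrable_finsetSum _ (hint i),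
    Finset.sum_congr rfl fun i _ => integral_finsetSum _ (hint i),
    Finset.sum_congr rfl fun i _ => Finset.sum_congr rfl (hval i)] at hle
  simp only [Finset.sum_const, nsmul_eq_mul, integral_const, probReal_univ, one_smul] at hle
  rwa [← Finset.sum_mul, sum_card_Ioi_fin] at hle

/-- The limit `n → ∞` in `energy_integral_le`. -/
theorem logEnergy_le_log_of_monic_bound {ν : Measure ℂ} [IsProbabilityMeasure ν] {K : Set ℂ}
    (hK : ν Kᶜ = 0) {R : ℝ} (hR : ∀ z ∈ K, ‖z‖ ≤ R)
    (P : ℕ → ℂ[X]) (hmonic : ∀ k, (P k).Monic) (hdeg : ∀ k, (P k).natDegree = k) {C ρ : ℝ}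
    (hC : 0 < C) (hρ : 0 < ρ) (hP : ∀ k, ∀ z ∈ K, ‖(P k).eval z‖ ≤ C * ρ ^ k) :
    logEnergy ν ≤ (Real.log ρ : EReal) := by
  rcases logEnergy_eq_bot_or hR hK with h | ⟨hd, hi⟩
  · simp [h]
  rw [logEnergy_eq_integral hd hi, EReal.coe_le_coe_iff]
  set I := ∫ p, Real.log ‖p.1 - p.2‖ ∂ν.prod ν
  have hsum : ∀ n : ℕ, ∑ k : Fin n, (k : ℝ) = n * (n - 1) / 2 := fun n => by
    rw [Fin.sum_univ_eq_sum_range (fun k => (k : ℝ)) n]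
    induction n with
    | zero => simp
    | succ n ih =>
      rw [Finset.sum_range_succ, ih]
      push_cast
      ring
  have key : ∀ n : ℕ, 2 ≤ n →
      I ≤ Real.log n ^ 1 / (1 * n + -1) + 2 * Real.log C * (Real.log n ^ 0 / (1 * n + -1))
        + Real.log ρ := by
    intro n hn
    have h := energy_integral_le hK hd hi P hmonic hdeg hC hρ hP n
    rw [hsum] at h
    have hn2 : (2 : ℝ) ≤ n := by exact_mod_cast hn
    have h1 : (0 : ℝ) < 1 * n + -1 := by linarith
    have h2 : (0 : ℝ) < n * (n - 1) / 2 := by nlinarith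
    refine le_of_mul_le_mul_left (h.trans_eq ?_) h2
    have h3 : (n : ℝ) - 1 ≠ 0 := by linarith
    rw [show (1 : ℝ) * n + -1 = n - 1 by ring]
    field_simp
  -- The error `(log n + 2 log C) / (n - 1)` tends to `0`.
  have hlim := ((Real.tendsto_pow_log_div_mul_add_atTop 1 (-1) 1 one_ne_zero).add
    ((Real.tendsto_pow_log_div_mul_add_atTop 1 (-1) 0 one_ne_zero).const_mul
      (2 * Real.log C))).add_const (Real.log ρ)
  have hlim' := hlim.comp tendsto_natCast_atTop_atTop
  simp only [mul_zero, add_zero, zero_add] at hlim'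
  refine ge_of_tendsto hlim' ?_
  filter_upwards [Filter.eventually_ge_atTop 2] with n hn
  exact key n hn

/-- Two-sided computation of the capacity: monic polynomials for the upper bound and a measure of
the right energy for the lower bound. -/
theorem logCapacity_eq_of_bounds {K : Set ℂ} {R : ℝ} (hR : ∀ z ∈ K, ‖z‖ ≤ R)
    (P : ℕ → ℂ[X]) (hmonic : ∀ k, (P k).Monic) (hdeg : ∀ k, (P k).natDegree = k) {C ρ : ℝ}
    (hC : 0 < C) (hρ : 0 < ρ) (hP : ∀ k, ∀ z ∈ K, ‖(P k).eval z‖ ≤ C * ρ ^ k)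
    (ν : Measure ℂ) [IsProbabilityMeasure ν] (hν : ν Kᶜ = 0)
    (hE : logEnergy ν = (Real.log ρ : EReal)) :
    logCapacity K = ENNReal.ofReal ρ := by
  have hexp : EReal.exp (Real.log ρ : EReal) = ENNReal.ofReal ρ := by
    rw [EReal.exp_coe, Real.exp_log hρ]
  refine le_antisymm ?_ ?_
  · refine iSup_le fun ν' => iSup_le fun _ => iSup_le fun hν' => ?_
    rw [← hexp]
    exact EReal.exp_monotone (logEnergy_le_log_of_monic_bound hν' hR P hmonic hdeg hC hρ hP)
  · rw [← hexp, ← hE]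
    exact le_iSup_of_le ν (le_iSup_of_le inferInstance (le_iSup_of_le hν le_rfl))

/-! ### The uniform distribution on the circle and the capacity of a disc -/

/-- The uniform probability measure on the interval `(0, 2π]` of angles. -/
noncomputable def angleMeasure : Measure ℝ :=
  (ENNReal.ofReal (2 * Real.pi))⁻¹ • volume.restrict (Ioc 0 (2 * Real.pi))

instance : IsProbabilityMeasure angleMeasure := by
  refine ⟨?_⟩
  simp only [angleMeasure, Measure.smul_apply, Measure.restrict_apply_univ, Real.volume_Ioc,
    sub_zero, smul_eq_mul]
  exact ENNReal.inv_mul_cancel (by simp [Real.pi_pos]) ENNReal.ofReal_ne_top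

instance : NullSingletonClass angleMeasure := by
  refine ⟨fun x => ?_⟩
  simp [angleMeasure]

theorem integral_angleMeasure_circleMap (f : ℂ → ℝ) (R : ℝ) :
    ∫ θ, f (circleMap 0 R θ) ∂angleMeasure = Real.circleAverage f 0 R := by
  rw [angleMeasure, integral_smul_measure, Real.circleAverage_def,
    intervalIntegral.integral_of_le Real.two_pi_pos.le, ENNReal.toReal_inv,
    ENNReal.toReal_ofReal Real.two_pi_pos.le]

theorem integrable_log_norm_circleMap_sub (R : ℝ) (a : ℂ) :
    Integrable (fun θ => Real.log ‖circleMap 0 R θ - a‖) angleMeasure := by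
  have h : CircleIntegrable (fun z => Real.log ‖z - a‖) 0 R := circleIntegrable_log_norm_sub_const R
  have h2 := (intervalIntegrable_iff_integrableOn_Ioc_of_le Real.two_pi_pos.le).1 h
  exact Integrable.smul_measure h2 (by simp [Real.pi_pos])

theorem angleMeasure_preimage_circleMap {S : Set ℂ} (hS : S.Countable) {R : ℝ} (hR : R ≠ 0) :
    angleMeasure (circleMap 0 R ⁻¹' S) = 0 :=
  (hS.preimage_circleMap 0 hR).measure_zero _

theorem integral_log_norm_circleMap_sub {R : ℝ} (hR : 0 < R) {a : ℂ} (ha : ‖a‖ ≤ R) :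
    ∫ θ, Real.log ‖circleMap 0 R θ - a‖ ∂angleMeasure = Real.log R := by
  rw [integral_angleMeasure_circleMap (fun z => Real.log ‖z - a‖)]
  apply circleAverage_log_norm_sub_const_of_mem_closedBall
  simpa [abs_of_pos hR] using ha

theorem circleMeasure_compl_closedBall {t : ℝ} (ht : 0 < t) :
    angleMeasure.map (circleMap 0 t) (Metric.closedBall 0 t)ᶜ = 0 := by
  rw [Measure.map_apply (continuous_circleMap 0 t).measurable
    Metric.isClosed_closedBall.measurableSet.compl]
  convert measure_empty (μ := angleMeasure)
  ext θ
  simp [abs_of_pos ht]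

/-- The potential of the uniform distribution on the circle of radius `t` equals `log t` on the whole
closed disc. -/
theorem logEnergy_circle {t : ℝ} (ht : 0 < t) :
    logEnergy (angleMeasure.map (circleMap 0 t)) = (Real.log t : EReal) := by
  have hm : Measurable (circleMap 0 t) := (continuous_circleMap 0 t).measurable
  have : IsProbabilityMeasure (angleMeasure.map (circleMap 0 t)) :=
    Measure.isProbabilityMeasure_map hm.aemeasurable
  have hlog : ∀ z : ℂ, Measurable fun w : ℂ => Real.log ‖z - w‖ := fun z => by fun_prop
  refine logEnergy_eq_of_potential_eq (K := Metric.closedBall 0 t) (R := t)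
    (fun z hz => by simpa using hz) ?_ ?_ ?_ ?_
  · exact circleMeasure_compl_closedBall ht
  · intro z _
    rw [Measure.map_apply hm (measurableSet_singleton z)]
    exact angleMeasure_preimage_circleMap (countable_singleton z) ht.ne'
  · intro z _
    rw [integrable_map_measure (hlog z).aestronglyMeasurable hm.aemeasurable]
    simpa only [Function.comp_def, norm_sub_rev z] using integrable_log_norm_circleMap_sub t z
  · intro z hz
    rw [integral_map hm.aemeasurable (hlog z).aestronglyMeasurable]
    simp_rw [norm_sub_rev z]
    exact integral_log_norm_circleMap_sub ht (by simpa using hz)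

theorem logCapacity_closedBall {t : ℝ} (ht : 0 < t) :
    logCapacity (Metric.closedBall (0 : ℂ) t) = ENNReal.ofReal t := by
  have hm : Measurable (circleMap 0 t) := (continuous_circleMap 0 t).measurable
  have : IsProbabilityMeasure (angleMeasure.map (circleMap 0 t)) :=
    Measure.isProbabilityMeasure_map hm.aemeasurable
  refine logCapacity_eq_of_bounds (R := t) (C := 1) (fun z hz => by simpa using hz)
    (fun k => Polynomial.X ^ k) (Polynomial.monic_X_pow) (Polynomial.natDegree_X_pow) one_pos ht
    (fun k z hz => ?_) (angleMeasure.map (circleMap 0 t))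
    (circleMeasure_compl_closedBall ht) (logEnergy_circle ht)
  have : ‖z‖ ≤ t := by simpa using hz
  simpa using pow_le_pow_left₀ (norm_nonneg z) this k

/-! ### The capacity of two symmetric intervals -/

theorem mem_twoIntervals_iff {j ε : ℝ} (hj : 0 < j) {z : ℂ} :
    z ∈ twoIntervals j ε ↔ ∃ x : ℝ, (x : ℂ) = z ∧ j ≤ |x| ∧ |x| ≤ j + ε := by
  constructor
  · rintro ⟨x, hx | hx, rfl⟩
    · exact ⟨x, rfl, by rw [abs_of_pos (by linarith [hx.1])]; exact hx⟩
    · refine ⟨x, rfl, ?_⟩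
      rw [abs_of_neg (by linarith [hx.2])]
      constructor <;> linarith [hx.1, hx.2]
  · rintro ⟨x, rfl, h1, h2⟩
    refine ⟨x, ?_, rfl⟩
    rcases le_total 0 x with h | h
    · rw [abs_of_nonneg h] at h1 h2
      exact Or.inl ⟨h1, h2⟩
    · rw [abs_of_nonpos h] at h1 h2
      exact Or.inr ⟨by linarith, by linarith⟩

theorem norm_le_of_mem_twoIntervals {j ε : ℝ} (hj : 0 < j) :
    ∀ z ∈ twoIntervals j ε, ‖z‖ ≤ j + ε := fun z hz => by
  obtain ⟨x, rfl, -, h⟩ := (mem_twoIntervals_iff hj).1 hz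
  simpa using h

theorem isCompact_twoIntervals (j ε : ℝ) : IsCompact (twoIntervals j ε) :=
  (isCompact_Icc.union isCompact_Icc).image Complex.continuous_ofReal

/-- The squares of the points of `[-j - ε, -j] ∪ [j, j + ε]` are the points of an interval with
midpoint `c` and half-length `2 s`. -/
theorem exists_sq_eq_of_mem_twoIntervals {j ε : ℝ} (hj : 0 < j) (hε : 0 < ε) {z : ℂ}
    (hz : z ∈ twoIntervals j ε) :
    ∃ φ : ℝ, z ^ 2 =
      ((((j + ε) ^ 2 + j ^ 2) / 2 + 2 * ((2 * j + ε) * ε / 4) * Real.cos φ : ℝ) : ℂ) := by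
  obtain ⟨x, rfl, h1, h2⟩ := (mem_twoIntervals_iff hj).1 hz
  have hs : 0 < (2 * j + ε) * ε / 4 := by positivity
  have h3 : j ^ 2 ≤ x ^ 2 := by
    rw [← sq_abs x]; exact pow_le_pow_left₀ hj.le h1 2
  have h4 : x ^ 2 ≤ (j + ε) ^ 2 := by
    rw [← sq_abs x]; exact pow_le_pow_left₀ (abs_nonneg x) h2 2
  refine ⟨Real.arccos ((x ^ 2 - ((j + ε) ^ 2 + j ^ 2) / 2) / (2 * ((2 * j + ε) * ε / 4))), ?_⟩
  rw [Real.cos_arccos, mul_div_cancel₀ _ (by positivity)]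
  · push_cast
    ring
  · rw [le_div_iff₀ (by positivity)]
    nlinarith
  · rw [div_le_iff₀ (by positivity)]
    nlinarith

/-- The monic Chebyshev polynomials of an interval of capacity `s`, composed with `z ^ 2`. -/
theorem exists_monic_chebyshev_sq (c : ℝ) {s : ℝ} (hs : 0 < s) (k : ℕ) :
    ∃ Q : ℂ[X], Q.Monic ∧ Q.natDegree = 2 * k ∧ ∀ (z : ℂ) (φ : ℝ),
      z ^ 2 = ((c + 2 * s * Real.cos φ : ℝ) : ℂ) → ‖Q.eval z‖ ≤ 2 * s ^ k := by
  have hs' : ((2 * s : ℝ) : ℂ)⁻¹ ≠ 0 := inv_ne_zero (by exact_mod_cast (by positivity : 2 * s ≠ 0))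
  set A : ℂ[X] := Polynomial.X ^ 2 - Polynomial.C (c : ℂ) with hA
  have hAdeg : A.natDegree = 2 := Polynomial.natDegree_X_pow_sub_C
  have hAmonic : A.Monic := Polynomial.monic_X_pow_sub_C _ two_ne_zero
  set B : ℂ[X] := Polynomial.C (((2 * s : ℝ) : ℂ)⁻¹) * A with hB
  have hBdeg : B.natDegree = 2 := by rw [hB, Polynomial.natDegree_C_mul hs', hAdeg]
  have hBlead : B.leadingCoeff = ((2 * s : ℝ) : ℂ)⁻¹ := by
    rw [hB, Polynomial.leadingCoeff_mul, Polynomial.leadingCoeff_C, hAmonic.leadingCoeff, mul_one]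
  set T : ℂ[X] := Polynomial.Chebyshev.T ℂ k with hT
  have hTdeg : T.natDegree = k := by simp [hT, Polynomial.Chebyshev.natDegree_T]
  have hTlead : T.leadingCoeff = 2 ^ (k - 1) := by simp [hT, Polynomial.Chebyshev.leadingCoeff_T]
  have hlead : (T.comp B).leadingCoeff = 2 ^ (k - 1) * (((2 * s : ℝ) : ℂ)⁻¹) ^ k := by
    rw [Polynomial.leadingCoeff_comp (by rw [hBdeg]; exact two_ne_zero), hTlead, hBlead, hTdeg]
  have hlead0 : (T.comp B).leadingCoeff ≠ 0 := by
    rw [hlead]; exact mul_ne_zero (pow_ne_zero _ two_ne_zero) (pow_ne_zero _ hs')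
  refine ⟨Polynomial.C (T.comp B).leadingCoeff⁻¹ * T.comp B, ?_, ?_, ?_⟩
  · rw [Polynomial.Monic, Polynomial.leadingCoeff_mul, Polynomial.leadingCoeff_C,
      inv_mul_cancel₀ hlead0]
  · rw [Polynomial.natDegree_C_mul (inv_ne_zero hlead0), Polynomial.natDegree_comp, hTdeg, hBdeg,
      mul_comm]
  · intro z φ hz
    have hBz : B.eval z = Complex.cos φ := by
      have : (s : ℂ) ≠ 0 := by exact_mod_cast hs.ne'
      simp only [hB, hA, Polynomial.eval_mul, Polynomial.eval_C, Polynomial.eval_sub,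
        Polynomial.eval_pow, Polynomial.eval_X, hz]
      push_cast
      field_simp
      ring
    have hTz : ‖T.eval (B.eval z)‖ ≤ 1 := by
      rw [hBz, hT, Polynomial.Chebyshev.T_complex_cos]
      have : Complex.cos (((k : ℤ) : ℂ) * φ) = ((Real.cos (k * φ) : ℝ) : ℂ) := by push_cast; rfl
      rw [this, Complex.norm_real]
      exact Real.abs_cos_le_one _
    have hnorm : ‖(T.comp B).leadingCoeff⁻¹‖ ≤ 2 * s ^ k := by
      rw [hlead, norm_inv, norm_mul, norm_pow, norm_pow, norm_inv, Complex.norm_real,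
        Real.norm_of_nonneg (by positivity), Complex.norm_two, mul_inv, inv_pow, inv_inv, mul_pow,
        ← mul_assoc]
      refine mul_le_mul_of_nonneg_right ?_ (by positivity)
      rw [inv_mul_le_iff₀ (by positivity), ← pow_succ]
      exact pow_le_pow_right₀ one_le_two (by omega)
    rw [Polynomial.eval_mul, Polynomial.eval_C, Polynomial.eval_comp, norm_mul]
    calc _ ≤ 2 * s ^ k * 1 := mul_le_mul hnorm hTz (norm_nonneg _) (by positivity)
      _ = _ := mul_one _

/-- Chebyshev polynomials in `z ^ 2` in even degrees, and their products with `z` in odd degrees. -/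
theorem exists_monic_bound_twoIntervals {j ε : ℝ} (hj : 0 < j) (hε : 0 < ε) :
    ∃ (P : ℕ → ℂ[X]) (C : ℝ), 0 < C ∧ (∀ k, (P k).Monic) ∧ (∀ k, (P k).natDegree = k) ∧
      ∀ k, ∀ z ∈ twoIntervals j ε,
        ‖(P k).eval z‖ ≤ C * (Real.sqrt ((2 * j + ε) * ε / 4)) ^ k := by
  have hs : 0 < (2 * j + ε) * ε / 4 := by positivity
  choose Q hQ1 hQ2 hQ3 using exists_monic_chebyshev_sq (((j + ε) ^ 2 + j ^ 2) / 2) hs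
  set ρ := Real.sqrt ((2 * j + ε) * ε / 4) with hρ
  have hρ0 : 0 < ρ := Real.sqrt_pos.2 hs
  have hρ2 : ρ ^ 2 = (2 * j + ε) * ε / 4 := Real.sq_sqrt hs.le
  refine ⟨fun k => Polynomial.X ^ (k % 2) * Q (k / 2), 2 * (1 + (j + ε) / ρ), by positivity,
    fun k => (Polynomial.monic_X_pow _).mul (hQ1 _), fun k => ?_, fun k z hz => ?_⟩
  · rw [(Polynomial.monic_X_pow _).natDegree_mul (hQ1 _), Polynomial.natDegree_X_pow, hQ2]
    omega
  · obtain ⟨φ, hφ⟩ := exists_sq_eq_of_mem_twoIntervals hj hε hz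
    have hQz := hQ3 (k / 2) z φ hφ
    have hzn : ‖z‖ ≤ j + ε := norm_le_of_mem_twoIntervals hj z hz
    have hX : ‖z‖ ^ (k % 2) ≤ (1 + (j + ε) / ρ) * ρ ^ (k % 2) := by
      rcases Nat.mod_two_eq_zero_or_one k with h | h <;> rw [h]
      · have : 0 ≤ (j + ε) / ρ := by positivity
        simpa using this
      · rw [pow_one, pow_one, add_mul, div_mul_cancel₀ _ hρ0.ne']
        linarith
    rw [Polynomial.eval_mul, Polynomial.eval_pow, Polynomial.eval_X, norm_mul, norm_pow]
    calc ‖z‖ ^ (k % 2) * ‖(Q (k / 2)).eval z‖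
        ≤ ((1 + (j + ε) / ρ) * ρ ^ (k % 2)) * (2 * ((2 * j + ε) * ε / 4) ^ (k / 2)) :=
          mul_le_mul hX hQz (norm_nonneg _) (by positivity)
      _ = 2 * (1 + (j + ε) / ρ) * ρ ^ (k % 2 + 2 * (k / 2)) := by
          rw [← hρ2, ← pow_mul, pow_add]
          ring
      _ = _ := by rw [Nat.mod_add_div]

/-- With `u = exp (iθ)` and `a = exp (iφ)`, the difference of `2 cos φ` and `2 cos θ` is
`-(u - a) (u - a⁻¹) / u`. -/
theorem norm_two_cos_sub_two_cos (φ θ : ℝ) :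
    ‖((2 * Real.cos φ - 2 * Real.cos θ : ℝ) : ℂ)‖ =
      ‖circleMap 0 1 θ - circleMap 0 1 φ‖ * ‖circleMap 0 1 θ - circleMap 0 1 (-φ)‖ := by
  have hu : ‖circleMap 0 1 θ‖ = 1 := by simp
  have h : circleMap 0 1 θ * ((2 * Real.cos φ - 2 * Real.cos θ : ℝ) : ℂ) =
      -((circleMap 0 1 θ - circleMap 0 1 φ) * (circleMap 0 1 θ - circleMap 0 1 (-φ))) := by
    have h1 : Complex.exp (θ * Complex.I) * Complex.exp (-θ * Complex.I) = 1 := by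
      rw [← Complex.exp_add]; simp
    have h2 : Complex.exp (φ * Complex.I) * Complex.exp (-φ * Complex.I) = 1 := by
      rw [← Complex.exp_add]; simp
    simp only [circleMap, zero_add, Complex.ofReal_one, one_mul]
    push_cast
    rw [Complex.two_cos, Complex.two_cos]
    linear_combination h2 - h1
  rw [← norm_mul, ← norm_neg (_ * _), ← h, norm_mul, hu, one_mul]

theorem abs_log_le_abs_log_add_log {a b M : ℝ} (ha0 : 0 < a) (hb0 : 0 < b) (ha : a ≤ M)
    (hb : b ≤ M) (hM : 1 ≤ M) : |Real.log a| ≤ |Real.log a + Real.log b| + Real.log M := by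
  have h1 := Real.log_le_log ha0 ha
  have h2 := Real.log_le_log hb0 hb
  have h3 := Real.log_nonneg hM
  have h4 := abs_nonneg (Real.log a + Real.log b)
  have h5 := neg_abs_le (Real.log a + Real.log b)
  rw [abs_le]
  constructor <;> linarith

/-- The positive point of `[j, j + ε]` whose square is at angle `θ` in the parametrization of
`[j ^ 2, (j + ε) ^ 2]` by the cosine. -/
noncomputable def intervalPoint (j ε θ : ℝ) : ℝ :=
  Real.sqrt (((j + ε) ^ 2 + j ^ 2) / 2 + 2 * ((2 * j + ε) * ε / 4) * Real.cos θ)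

theorem continuous_intervalPoint (j ε : ℝ) : Continuous (intervalPoint j ε) := by
  unfold intervalPoint
  fun_prop

theorem intervalPoint_mem {j ε : ℝ} (hj : 0 < j) (hε : 0 < ε) (θ : ℝ) :
    intervalPoint j ε θ ∈ Icc j (j + ε) := by
  have hs : 0 < (2 * j + ε) * ε / 4 := by positivity
  have h1 := Real.cos_le_one θ
  have h2 := Real.neg_one_le_cos θ
  constructor
  · exact Real.le_sqrt_of_sq_le (by nlinarith)
  · exact Real.sqrt_le_iff.2 ⟨by positivity, by nlinarith⟩

theorem sq_intervalPoint {j ε : ℝ} (hj : 0 < j) (hε : 0 < ε) (θ : ℝ) :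
    intervalPoint j ε θ ^ 2 =
      ((j + ε) ^ 2 + j ^ 2) / 2 + 2 * ((2 * j + ε) * ε / 4) * Real.cos θ := by
  refine Real.sq_sqrt ?_
  -- A negative radicand would make the square root vanish.
  have h := (intervalPoint_mem hj hε θ).1
  by_contra! hc
  rw [intervalPoint, Real.sqrt_eq_zero_of_nonpos hc.le] at h
  linarith

/-- The factorization behind the potential of the equilibrium measure: the product of the
distances of `z` to `x` and to `-x` is a product of distances on the unit circle. -/
theorem norm_sub_mul_norm_add_intervalPoint {j ε : ℝ} (hj : 0 < j) (hε : 0 < ε) {z : ℂ} {φ : ℝ}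
    (hφ : z ^ 2 = ((((j + ε) ^ 2 + j ^ 2) / 2 + 2 * ((2 * j + ε) * ε / 4) * Real.cos φ : ℝ) : ℂ))
    (θ : ℝ) :
    ‖z - (intervalPoint j ε θ : ℂ)‖ * ‖z - (-(intervalPoint j ε θ : ℝ) : ℂ)‖ =
      (2 * j + ε) * ε / 4 *
        (‖circleMap 0 1 θ - circleMap 0 1 φ‖ * ‖circleMap 0 1 θ - circleMap 0 1 (-φ)‖) := by
  have hs : 0 < (2 * j + ε) * ε / 4 := by positivity
  have hx : ((intervalPoint j ε θ : ℝ) : ℂ) ^ 2 =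
      ((((j + ε) ^ 2 + j ^ 2) / 2 + 2 * ((2 * j + ε) * ε / 4) * Real.cos θ : ℝ) : ℂ) := by
    rw [← sq_intervalPoint hj hε θ]; push_cast; rfl
  rw [← norm_mul, ← norm_two_cos_sub_two_cos, sub_neg_eq_add, mul_comm (z - _), ← sq_sub_sq, hφ, hx]
  rw [← Complex.ofReal_sub, Complex.norm_real, Complex.norm_real, Real.norm_eq_abs,
    Real.norm_eq_abs]
  conv_rhs => rw [← abs_of_pos hs, ← abs_mul]
  congr 1
  ring

/-- On the two intervals the logarithms of the distances to `x` and to `-x`, where `x` is the random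
point `intervalPoint j ε θ`, have means adding up to the constant `log ((2 j + ε) ε / 4)`. -/
theorem potential_twoIntervals {j ε : ℝ} (hj : 0 < j) (hε : 0 < ε) {z : ℂ}
    (hz : z ∈ twoIntervals j ε) :
    (∀ᵐ θ ∂angleMeasure, z ≠ (intervalPoint j ε θ : ℂ) ∧ z ≠ (-(intervalPoint j ε θ : ℝ) : ℂ)) ∧
    Integrable (fun θ => Real.log ‖z - (intervalPoint j ε θ : ℂ)‖) angleMeasure ∧
    Integrable (fun θ => Real.log ‖z - (-(intervalPoint j ε θ : ℝ) : ℂ)‖) angleMeasure ∧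
    ∫ θ, Real.log ‖z - (intervalPoint j ε θ : ℂ)‖ ∂angleMeasure +
      ∫ θ, Real.log ‖z - (-(intervalPoint j ε θ : ℝ) : ℂ)‖ ∂angleMeasure =
        Real.log ((2 * j + ε) * ε / 4) := by
  have hs : 0 < (2 * j + ε) * ε / 4 := by positivity
  obtain ⟨φ, hφ⟩ := exists_sq_eq_of_mem_twoIntervals hj hε hz
  have hfac := norm_sub_mul_norm_add_intervalPoint hj hε hφ
  have hne : ∀ᵐ θ ∂angleMeasure,
      circleMap 0 1 θ ≠ circleMap 0 1 φ ∧ circleMap 0 1 θ ≠ circleMap 0 1 (-φ) := by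
    have h : ∀ a : ℂ, ∀ᵐ θ ∂angleMeasure, circleMap 0 1 θ ≠ a := fun a => by
      have := angleMeasure_preimage_circleMap (countable_singleton a) one_ne_zero
      filter_upwards [measure_eq_zero_iff_ae_notMem.1 this] with θ hθ using hθ
    exact (h _).and (h _)
  have hne' : ∀ᵐ θ ∂angleMeasure,
      0 < ‖z - (intervalPoint j ε θ : ℂ)‖ ∧ 0 < ‖z - (-(intervalPoint j ε θ : ℝ) : ℂ)‖ := by
    filter_upwards [hne] with θ hθ
    have hpos : 0 < ‖z - (intervalPoint j ε θ : ℂ)‖ * ‖z - (-(intervalPoint j ε θ : ℝ) : ℂ)‖ := by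
      rw [hfac]
      exact mul_pos hs (mul_pos (norm_pos_iff.2 (sub_ne_zero.2 hθ.1))
        (norm_pos_iff.2 (sub_ne_zero.2 hθ.2)))
    exact ⟨pos_of_mul_pos_left hpos (norm_nonneg _), pos_of_mul_pos_right hpos (norm_nonneg _)⟩
  have hlog : ∀ᵐ θ ∂angleMeasure, Real.log ‖z - (intervalPoint j ε θ : ℂ)‖ +
      Real.log ‖z - (-(intervalPoint j ε θ : ℝ) : ℂ)‖ = Real.log ((2 * j + ε) * ε / 4) +
        (Real.log ‖circleMap 0 1 θ - circleMap 0 1 φ‖ +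
          Real.log ‖circleMap 0 1 θ - circleMap 0 1 (-φ)‖) := by
    filter_upwards [hne, hne'] with θ h1 h2
    have h3 := norm_ne_zero_iff.2 (sub_ne_zero.2 h1.1)
    have h4 := norm_ne_zero_iff.2 (sub_ne_zero.2 h1.2)
    rw [← Real.log_mul h2.1.ne' h2.2.ne', hfac, Real.log_mul hs.ne' (mul_ne_zero h3 h4),
      Real.log_mul h3 h4]
  have hi1 := integrable_log_norm_circleMap_sub 1 (circleMap 0 1 φ)
  have hi2 := integrable_log_norm_circleMap_sub 1 (circleMap 0 1 (-φ))
  have hi12 : Integrable (fun θ => Real.log ‖circleMap 0 1 θ - circleMap 0 1 φ‖ +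
      Real.log ‖circleMap 0 1 θ - circleMap 0 1 (-φ)‖) angleMeasure := hi1.add hi2
  have hi3 : Integrable (fun θ => Real.log ‖z - (intervalPoint j ε θ : ℂ)‖ +
      Real.log ‖z - (-(intervalPoint j ε θ : ℝ) : ℂ)‖) angleMeasure :=
    ((integrable_const _).add hi12).congr (hlog.mono fun θ h => h.symm)
  have hcont := continuous_intervalPoint j ε
  have hbound : ∀ θ, ‖z - (intervalPoint j ε θ : ℂ)‖ ≤ 2 * (j + ε) + 1 ∧
      ‖z - (-(intervalPoint j ε θ : ℝ) : ℂ)‖ ≤ 2 * (j + ε) + 1 := fun θ => by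
    have hzn : ‖z‖ ≤ j + ε := norm_le_of_mem_twoIntervals hj z hz
    have hx := intervalPoint_mem hj hε θ
    have hxn : ‖(intervalPoint j ε θ : ℂ)‖ ≤ j + ε := by
      rw [Complex.norm_real, Real.norm_of_nonneg (hj.le.trans hx.1)]
      exact hx.2
    have h1 := norm_sub_le z (intervalPoint j ε θ : ℂ)
    have h2 := norm_sub_le z (-(intervalPoint j ε θ : ℝ) : ℂ)
    rw [norm_neg] at h2
    constructor <;> linarith
  have hM : 1 ≤ 2 * (j + ε) + 1 := by linarith
  -- Both factors are bounded, so each logarithm is controlled by the logarithm of the product.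
  have hint1 : Integrable (fun θ => Real.log ‖z - (intervalPoint j ε θ : ℂ)‖) angleMeasure := by
    refine Integrable.mono' (hi3.norm.add (integrable_const (Real.log (2 * (j + ε) + 1))))
      (Measurable.aestronglyMeasurable (by fun_prop)) ?_
    filter_upwards [hne'] with θ h
    exact abs_log_le_abs_log_add_log h.1 h.2 (hbound θ).1 (hbound θ).2 hM
  have hint2 : Integrable (fun θ => Real.log ‖z - (-(intervalPoint j ε θ : ℝ) : ℂ)‖)
      angleMeasure := by
    refine (hi3.sub hint1).congr (Filter.Eventually.of_forall fun θ => ?_)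
    simp
  refine ⟨?_, hint1, hint2, ?_⟩
  · filter_upwards [hne'] with θ h
    exact ⟨sub_ne_zero.1 (norm_pos_iff.1 h.1), sub_ne_zero.1 (norm_pos_iff.1 h.2)⟩
  · have hn : ∀ ψ : ℝ, ‖circleMap 0 1 ψ‖ ≤ 1 := fun ψ => by simp
    rw [← integral_add hint1 hint2, integral_congr_ae hlog,
      integral_add (integrable_const _) hi12, integral_add hi1 hi2,
      integral_log_norm_circleMap_sub one_pos (hn _), integral_log_norm_circleMap_sub one_pos (hn _)]
    simp

/-- The equilibrium measure of the two intervals: the arcsine law of `[j ^ 2, (j + ε) ^ 2]`,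
pulled back to both square roots with equal weights. -/
noncomputable def twoIntervalsMeasure (j ε : ℝ) : Measure ℂ :=
  (2 : ℝ≥0∞)⁻¹ • (angleMeasure.map (fun θ => (intervalPoint j ε θ : ℂ)) +
    angleMeasure.map (fun θ => (-(intervalPoint j ε θ : ℝ) : ℂ)))

theorem measurable_intervalPoint_ofReal (j ε : ℝ) :
    Measurable fun θ => (intervalPoint j ε θ : ℂ) := by
  have := continuous_intervalPoint j ε
  fun_prop

theorem measurable_neg_intervalPoint_ofReal (j ε : ℝ) :
    Measurable fun θ => (-(intervalPoint j ε θ : ℝ) : ℂ) :=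
  (measurable_intervalPoint_ofReal j ε).neg

instance (j ε : ℝ) : IsProbabilityMeasure (twoIntervalsMeasure j ε) := by
  have h1 : IsProbabilityMeasure (angleMeasure.map (fun θ => (intervalPoint j ε θ : ℂ))) :=
    Measure.isProbabilityMeasure_map (measurable_intervalPoint_ofReal j ε).aemeasurable
  have h2 : IsProbabilityMeasure (angleMeasure.map (fun θ => (-(intervalPoint j ε θ : ℝ) : ℂ))) :=
    Measure.isProbabilityMeasure_map (measurable_neg_intervalPoint_ofReal j ε).aemeasurable
  refine ⟨?_⟩
  simp only [twoIntervalsMeasure, Measure.smul_apply, Measure.add_apply, measure_univ, smul_eq_mul]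
  rw [one_add_one_eq_two, ENNReal.inv_mul_cancel two_ne_zero ENNReal.ofNat_ne_top]

theorem twoIntervalsMeasure_apply_eq_zero {j ε : ℝ} {S : Set ℂ} (hS : MeasurableSet S)
    (h : ∀ᵐ θ ∂angleMeasure, (intervalPoint j ε θ : ℂ) ∉ S ∧ (-(intervalPoint j ε θ : ℝ) : ℂ) ∉ S) :
    twoIntervalsMeasure j ε S = 0 := by
  have h1 : angleMeasure ((fun θ => (intervalPoint j ε θ : ℂ)) ⁻¹' S) = 0 :=
    measure_eq_zero_iff_ae_notMem.2 (h.mono fun θ h => h.1)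
  have h2 : angleMeasure ((fun θ => (-(intervalPoint j ε θ : ℝ) : ℂ)) ⁻¹' S) = 0 :=
    measure_eq_zero_iff_ae_notMem.2 (h.mono fun θ h => h.2)
  rw [twoIntervalsMeasure, Measure.smul_apply, Measure.add_apply,
    Measure.map_apply (measurable_intervalPoint_ofReal j ε) hS,
    Measure.map_apply (measurable_neg_intervalPoint_ofReal j ε) hS, h1, h2]
  simp

theorem twoIntervalsMeasure_compl {j ε : ℝ} (hj : 0 < j) (hε : 0 < ε) :
    twoIntervalsMeasure j ε (twoIntervals j ε)ᶜ = 0 := by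
  refine twoIntervalsMeasure_apply_eq_zero
    (isCompact_twoIntervals j ε).isClosed.measurableSet.compl
    (Filter.Eventually.of_forall fun θ => ?_)
  have h := intervalPoint_mem hj hε θ
  refine ⟨not_not.2 ⟨_, Or.inl h, rfl⟩, not_not.2 ⟨-intervalPoint j ε θ, Or.inr ?_, by simp⟩⟩
  constructor <;> linarith [h.1, h.2]

theorem logEnergy_twoIntervalsMeasure {j ε : ℝ} (hj : 0 < j) (hε : 0 < ε) :
    logEnergy (twoIntervalsMeasure j ε) =
      (Real.log (Real.sqrt ((2 * j + ε) * ε / 4)) : EReal) := by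
  have hs : 0 < (2 * j + ε) * ε / 4 := by positivity
  have hm1 := measurable_intervalPoint_ofReal j ε
  have hm2 := measurable_neg_intervalPoint_ofReal j ε
  have hlog : ∀ z : ℂ, Measurable fun w : ℂ => Real.log ‖z - w‖ := fun z => by fun_prop
  have hint : ∀ z ∈ twoIntervals j ε,
      Integrable (fun w => Real.log ‖z - w‖) (angleMeasure.map (fun θ => (intervalPoint j ε θ : ℂ)))
      ∧ Integrable (fun w => Real.log ‖z - w‖)
        (angleMeasure.map (fun θ => (-(intervalPoint j ε θ : ℝ) : ℂ))) := fun z hz => by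
    rw [integrable_map_measure (hlog z).aestronglyMeasurable hm1.aemeasurable,
      integrable_map_measure (hlog z).aestronglyMeasurable hm2.aemeasurable]
    exact ⟨(potential_twoIntervals hj hε hz).2.1, (potential_twoIntervals hj hε hz).2.2.1⟩
  refine logEnergy_eq_of_potential_eq (norm_le_of_mem_twoIntervals hj)
    (twoIntervalsMeasure_compl hj hε) (fun z hz => ?_) (fun z hz => ?_) (fun z hz => ?_)
  · refine twoIntervalsMeasure_apply_eq_zero (measurableSet_singleton z) ?_
    filter_upwards [(potential_twoIntervals hj hε hz).1] with θ h
    exact ⟨fun h' => h.1 h'.symm, fun h' => h.2 h'.symm⟩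
  · exact ((hint z hz).1.add_measure (hint z hz).2).smul_measure (by simp)
  · rw [twoIntervalsMeasure, integral_smul_measure,
      integral_add_measure (hint z hz).1 (hint z hz).2,
      integral_map hm1.aemeasurable (hlog z).aestronglyMeasurable,
      integral_map hm2.aemeasurable (hlog z).aestronglyMeasurable,
      (potential_twoIntervals hj hε hz).2.2.2, Real.log_sqrt hs.le]
    simp
    ring

theorem logCapacity_twoIntervals {j ε : ℝ} (hj : 0 < j) (hε : 0 < ε) :
    logCapacity (twoIntervals j ε) =
      ENNReal.ofReal (1 / 2 * Real.sqrt ((2 * j + ε) * ε)) := by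
  obtain ⟨P, C, hC, hmonic, hdeg, hP⟩ := exists_monic_bound_twoIntervals hj hε
  rw [logCapacity_eq_of_bounds (norm_le_of_mem_twoIntervals hj) P hmonic hdeg hC
    (Real.sqrt_pos.2 (by positivity)) hP (twoIntervalsMeasure j ε)
    (twoIntervalsMeasure_compl hj hε) (logEnergy_twoIntervalsMeasure hj hε),
    Real.sqrt_div' _ (by norm_num), show (4 : ℝ) = 2 ^ 2 by norm_num,
    Real.sqrt_sq (by norm_num)]
  congr 1
  ring

/-! ### Areas of lemniscates -/

theorem norm_eval_prod_X_sub_C {n : ℕ} (z : Fin n → ℂ) (w : ℂ) :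
    ‖(∏ i, (Polynomial.X - Polynomial.C (z i))).eval w‖ = ∏ i, ‖w - z i‖ := by
  simp [Polynomial.eval_prod]

/-- If the zeros lie in the disc of radius `t`, the mean of `log |p|` over a larger circle of
radius `ρ` is `n log ρ`, so that `|p| ≤ ρ ^ n` at some point of this circle. -/
theorem exists_norm_eval_le_pow {n : ℕ} (z : Fin n → ℂ) {ρ : ℝ} (hρ : 0 < ρ)
    (hz : ∀ i, ‖z i‖ < ρ) : ∃ w : ℂ, ‖w‖ = ρ ∧ ∏ i, ‖w - z i‖ ≤ ρ ^ n := by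
  have hint : ∀ i, Integrable (fun θ => Real.log ‖circleMap 0 ρ θ - z i‖) angleMeasure :=
    fun i => integrable_log_norm_circleMap_sub ρ (z i)
  have hmean : ∫ θ, ∑ i, Real.log ‖circleMap 0 ρ θ - z i‖ ∂angleMeasure = n * Real.log ρ := by
    rw [integral_finsetSum _ fun i _ => hint i]
    simp [fun i => integral_log_norm_circleMap_sub hρ (hz i).le]
  -- On a probability space some value is at most the mean.
  obtain ⟨θ, hθ⟩ := exists_le_integral (integrable_finsetSum Finset.univ fun i _ => hint i)
  refine ⟨circleMap 0 ρ θ, by simp [abs_of_pos hρ], ?_⟩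
  have hne : ∀ i, 0 < ‖circleMap 0 ρ θ - z i‖ := fun i => by
    rw [norm_pos_iff, sub_ne_zero]
    intro h
    have := hz i
    rw [← h] at this
    simp [abs_of_pos hρ] at this
  rw [hmean, ← Real.log_prod fun i _ => (hne i).ne', ← Real.log_pow] at hθ
  exact (Real.log_le_log_iff (Finset.prod_pos fun i _ => hne i) (pow_pos hρ n)).1 hθ

/-- With `ρ = (1 + t) / 2` and `δ = (1 - t) / 2`, a point `w` of the circle of radius `ρ` has
distance at least `δ` from all zeros; moving it by less than `δ ^ 2 / ρ` increases each distance by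
a factor less than `1 + δ / ρ = 1 / ρ`. -/
theorem area_le_infLemniscateArea_closedBall {t : ℝ} (ht0 : 0 < t) (ht1 : t < 1) :
    ∃ r : ℝ, 0 < r ∧
      ENNReal.ofReal (Real.pi * r ^ 2) ≤ infLemniscateArea (Metric.closedBall (0 : ℂ) t) := by
  set ρ := (1 + t) / 2 with hρ
  set δ := (1 - t) / 2 with hδ
  have hρ0 : 0 < ρ := by linarith
  have hδ0 : 0 < δ := by linarith
  have hr : 0 < δ ^ 2 / ρ := by positivity
  refine ⟨δ ^ 2 / ρ, hr, le_iInf₂ fun n hn => le_iInf₂ fun p hp => ?_⟩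
  obtain ⟨z, hz, rfl⟩ := hp
  have hzt : ∀ i, ‖z i‖ ≤ t := fun i => by simpa using hz i
  obtain ⟨w, hw, hwp⟩ := exists_norm_eval_le_pow z hρ0 fun i => (hzt i).trans_lt (by linarith)
  have hsub : Metric.ball w (δ ^ 2 / ρ) ⊆
      unitLemniscate (∏ i, (Polynomial.X - Polynomial.C (z i))) := by
    intro y hy
    rw [mem_ball_iff_norm] at hy
    simp only [unitLemniscate, mem_ofPred_eq, norm_eval_prod_X_sub_C]
    have hdist : ∀ i, δ ≤ ‖w - z i‖ := fun i => by
      have := norm_sub_norm_le w (z i)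
      have := hzt i
      rw [hw] at *
      linarith
    have hstep : ∀ i, ‖y - z i‖ < ‖w - z i‖ * ρ⁻¹ := fun i => by
      have h1 : ‖y - z i‖ ≤ ‖y - w‖ + ‖w - z i‖ := norm_sub_le_norm_sub_add_norm_sub y w (z i)
      have h2 : δ ^ 2 / ρ ≤ ‖w - z i‖ * (δ / ρ) := by
        rw [pow_two, mul_div_assoc]
        exact mul_le_mul_of_nonneg_right (hdist i) (by positivity)
      have h3 : ‖w - z i‖ * ρ⁻¹ = ‖w - z i‖ * (δ / ρ) + ‖w - z i‖ := by
        have : δ = 1 - ρ := by rw [hρ, hδ]; ring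
        rw [this]
        field_simp
        ring
      linarith
    have hne : (Finset.univ : Finset (Fin n)).Nonempty :=
      ⟨⟨0, hn⟩, Finset.mem_univ _⟩
    have hpos : ∀ i, 0 < ‖w - z i‖ * ρ⁻¹ := fun i =>
      mul_pos (hδ0.trans_le (hdist i)) (inv_pos.2 hρ0)
    have hlt : ∏ i, ‖y - z i‖ < ∏ i, ‖w - z i‖ * ρ⁻¹ := by
      rcases (Finset.prod_nonneg fun i _ => norm_nonneg (y - z i) :
        0 ≤ ∏ i, ‖y - z i‖).eq_or_lt with h | h
      · rw [← h]
        exact Finset.prod_pos fun i _ => hpos i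
      · refine Finset.prod_lt_prod_of_nonempty (fun i _ => ?_) (fun i _ => hstep i) hne
        exact (norm_nonneg _).lt_of_ne' (Finset.prod_ne_zero_iff.1 h.ne' i (Finset.mem_univ i))
    refine hlt.trans_le ?_
    rw [Finset.prod_mul_distrib, Finset.prod_const, Finset.card_univ, Fintype.card_fin, inv_pow,
      ← div_eq_mul_inv, div_le_one (pow_pos hρ0 n)]
    exact hwp
  refine le_trans (le_of_eq ?_) (measure_mono hsub)
  rw [Complex.volume_ball, mul_comm Real.pi, ENNReal.ofReal_mul (by positivity),
    ENNReal.ofReal_pow hr.le, ← NNReal.coe_real_pi, ENNReal.ofReal_coe_nnreal]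

/-- Applied to the distances `u` and `v` of a point to the nearer and the farther of the two zeros
`± j`, which satisfy `v ≥ j`: a value of modulus less than `1` forces `u < j ^ (-1/2)`. -/
theorem sq_mul_lt_one_of_pow_mul_pow_lt_one {a b : ℕ} (hab : a ≤ 2 * b) {j u v : ℝ} (hj : 2 ≤ j)
    (hu : 0 ≤ u) (hv : j ≤ v) (h : u ^ a * v ^ b < 1) : u ^ 2 * j < 1 := by
  by_contra! hc
  have hv1 : 1 ≤ v ^ b := one_le_pow₀ (by linarith)
  have h1 : u < 1 := by
    by_contra! hu1
    have : 1 ≤ u ^ a * v ^ b := one_le_mul_of_one_le_of_one_le (one_le_pow₀ hu1) hv1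
    linarith
  have : 1 ≤ u ^ a * v ^ b := calc
    1 ≤ (u ^ 2 * j) ^ b := one_le_pow₀ hc
    _ = u ^ (2 * b) * j ^ b := by rw [mul_pow, pow_mul]
    _ ≤ u ^ a * v ^ b := by
      gcongr ?_ * ?_
      · exact pow_le_pow_of_le_one hu h1.le hab
      · exact pow_le_pow_left₀ (by linarith) hv b
  linarith

theorem volume_two_balls_le {j : ℝ} (hj : 0 < j) (x y : ℂ) :
    volume (Metric.ball x (Real.sqrt j)⁻¹ ∪ Metric.ball y (Real.sqrt j)⁻¹) ≤
      ENNReal.ofReal (2 * Real.pi / j) := by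
  refine (measure_union_le _ _).trans (le_of_eq ?_)
  rw [Complex.volume_ball, Complex.volume_ball, ← ENNReal.ofReal_pow (by positivity), inv_pow,
    Real.sq_sqrt hj.le, ← two_mul, ← ENNReal.ofReal_coe_nnreal, NNReal.coe_real_pi,
    ← ENNReal.ofReal_mul (by positivity),
    show (2 : ℝ≥0∞) = ENNReal.ofReal 2 by simp, ← ENNReal.ofReal_mul (by positivity)]
  congr 1
  field_simp

/-- The test polynomial is `(z - j) ^ a (z + j) ^ b` with `a = ⌈n / 2⌉` and `b = ⌊n / 2⌋`. -/
theorem minLemniscateArea_twoIntervals_le {j ε : ℝ} (hj : 2 ≤ j) (hε : 0 < ε) {n : ℕ}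
    (hn : 2 ≤ n) :
    minLemniscateArea n (twoIntervals j ε) ≤ ENNReal.ofReal (2 * Real.pi / j) := by
  have hj0 : 0 < j := by linarith
  obtain ⟨a, b, rfl, hab, hba⟩ : ∃ a b : ℕ, n = a + b ∧ a ≤ 2 * b ∧ b ≤ 2 * a :=
    ⟨(n + 1) / 2, n / 2, by omega, by omega, by omega⟩
  set z : Fin (a + b) → ℂ := Fin.append (fun _ => (j : ℂ)) (fun _ => -(j : ℂ)) with hz
  have hp : (∏ i, (Polynomial.X - Polynomial.C (z i))) ∈
      monicZerosIn (a + b) (twoIntervals j ε) := by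
    refine ⟨z, fun i => ?_, rfl⟩
    refine Fin.addCases (fun i => ?_) (fun i => ?_) i
    · rw [hz, Fin.append_left]
      exact ⟨j, Or.inl ⟨le_rfl, by linarith⟩, rfl⟩
    · rw [hz, Fin.append_right]
      exact ⟨-j, Or.inr ⟨by linarith, le_rfl⟩, by push_cast; rfl⟩
  refine (iInf₂_le _ hp).trans (le_trans (measure_mono ?_) (volume_two_balls_le hj0 j (-j)))
  intro w hw
  simp only [unitLemniscate, mem_ofPred_eq, norm_eval_prod_X_sub_C] at hw
  simp only [Fin.prod_univ_add, hz,
    Fin.append_left, Fin.append_right, Finset.prod_const, Finset.card_univ, Fintype.card_fin,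
    sub_neg_eq_add] at hw
  have hball : ∀ u : ℝ, 0 ≤ u → u ^ 2 * j < 1 → u < (Real.sqrt j)⁻¹ := fun u hu h => by
    rw [← Real.sqrt_inv]
    refine Real.lt_sqrt_of_sq_lt ?_
    rwa [← one_div, lt_div_iff₀ hj0]
  rcases le_total 0 w.re with h | h
  · left
    rw [mem_ball_iff_norm]
    refine hball _ (norm_nonneg _) (sq_mul_lt_one_of_pow_mul_pow_lt_one hab hj (norm_nonneg _) ?_ hw)
    refine le_trans ?_ (Complex.re_le_norm _)
    simpa using h
  · right
    rw [mem_ball_iff_norm, sub_neg_eq_add]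
    rw [mul_comm] at hw
    refine hball _ (norm_nonneg _) (sq_mul_lt_one_of_pow_mul_pow_lt_one hba hj (norm_nonneg _) ?_ hw)
    rw [norm_sub_rev]
    refine le_trans ?_ (Complex.re_le_norm _)
    simpa using h

theorem infLemniscateArea_twoIntervals_le {j ε : ℝ} (hj : 2 ≤ j) (hε : 0 < ε) :
    infLemniscateArea (twoIntervals j ε) ≤ ENNReal.ofReal (2 * Real.pi / j) :=
  (iInf₂_le 2 one_le_two).trans (minLemniscateArea_twoIntervals_le hj hε le_rfl)

/-! ### Capacity does not determine the infimal area -/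

/-- The solution of `√((2 j + ε) ε) / 2 = t` is `ε = √(j ^ 2 + 4 t ^ 2) - j`. -/
theorem exists_logCapacity_twoIntervals_eq {j t : ℝ} (hj : 0 < j) (ht : 0 < t) :
    ∃ ε : ℝ, 0 < ε ∧ logCapacity (twoIntervals j ε) = ENNReal.ofReal t := by
  have hsq : Real.sqrt (j ^ 2 + 4 * t ^ 2) ^ 2 = j ^ 2 + 4 * t ^ 2 := Real.sq_sqrt (by positivity)
  have hε : 0 < Real.sqrt (j ^ 2 + 4 * t ^ 2) - j :=
    sub_pos.2 (Real.lt_sqrt_of_sq_lt (by nlinarith [sq_pos_of_pos ht]))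
  refine ⟨_, hε, ?_⟩
  rw [logCapacity_twoIntervals hj hε]
  congr 1
  have : (2 * j + (Real.sqrt (j ^ 2 + 4 * t ^ 2) - j)) * (Real.sqrt (j ^ 2 + 4 * t ^ 2) - j) =
      (2 * t) ^ 2 := by linear_combination hsq
  rw [this, Real.sqrt_sq (by positivity)]
  ring

/-- For fixed capacity `t < 1`, the two-interval sets have arbitrarily small infimal area as
`j → ∞`, while that of the disc is positive. -/
theorem exists_logCapacity_eq_infLemniscateArea_ne {t : ℝ} (ht0 : 0 < t) (ht1 : t < 1) :
    ∃ K₁ K₂ : Set ℂ, IsCompact K₁ ∧ IsCompact K₂ ∧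
      logCapacity K₁ = ENNReal.ofReal t ∧ logCapacity K₂ = ENNReal.ofReal t ∧
      infLemniscateArea K₁ ≠ infLemniscateArea K₂ := by
  obtain ⟨r, hr, hdisc⟩ := area_le_infLemniscateArea_closedBall ht0 ht1
  set j : ℝ := 2 + 2 / r ^ 2 with hjdef
  have hj : 2 ≤ j := by rw [hjdef]; linarith [show 0 < 2 / r ^ 2 by positivity]
  obtain ⟨ε, hε, hcap⟩ := exists_logCapacity_twoIntervals_eq (by linarith : 0 < j) ht0
  refine ⟨twoIntervals j ε, Metric.closedBall 0 t, isCompact_twoIntervals j ε,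
    isCompact_closedBall 0 t, hcap, logCapacity_closedBall ht0, ne_of_lt ?_⟩
  refine (infLemniscateArea_twoIntervals_le hj hε).trans_lt (lt_of_lt_of_le ?_ hdisc)
  refine (ENNReal.ofReal_lt_ofReal_iff (by positivity)).2 ?_
  rw [div_lt_iff₀ (by linarith), hjdef, mul_add,
    show Real.pi * r ^ 2 * (2 / r ^ 2) = 2 * Real.pi by field_simp]
  linarith [show 0 < Real.pi * r ^ 2 * 2 by positivity]

theorem mainTheorem2 :
    (∀ t : ℝ, 0 < t → t < 1 →
      -- the two-interval sets
      (∀ j : ℝ, 2 ≤ j →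
        (∀ ε : ℝ, 0 < ε →
          logCapacity (twoIntervals j ε) =
            ENNReal.ofReal (1 / 2 * Real.sqrt ((2 * j + ε) * ε))) ∧
        ∃ ε : ℝ, 0 < ε ∧
          logCapacity (twoIntervals j ε) = ENNReal.ofReal t ∧
          (∀ n : ℕ, 2 ≤ n →
            minLemniscateArea n (twoIntervals j ε) ≤ ENNReal.ofReal (2 * Real.pi / j)) ∧
          infLemniscateArea (twoIntervals j ε) ≤ ENNReal.ofReal (2 * Real.pi / j)) ∧
      -- the disc of radius `t`
      logCapacity (Metric.closedBall (0 : ℂ) t) = ENNReal.ofReal t ∧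
      (∃ r : ℝ, 0 < r ∧
        ENNReal.ofReal (Real.pi * r ^ 2) ≤ infLemniscateArea (Metric.closedBall (0 : ℂ) t)) ∧
      -- two compact sets of capacity `t` with different `μ`
      (∃ K₁ K₂ : Set ℂ, IsCompact K₁ ∧ IsCompact K₂ ∧
        logCapacity K₁ = ENNReal.ofReal t ∧ logCapacity K₂ = ENNReal.ofReal t ∧
        infLemniscateArea K₁ ≠ infLemniscateArea K₂)) ∧
    -- the negative answer to the question
    ¬ (∀ K₁ K₂ : Set ℂ, IsCompact K₁ → IsCompact K₂ →
        logCapacity K₁ = logCapacity K₂ → infLemniscateArea K₁ = infLemniscateArea K₂) := by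
  refine ⟨fun t ht0 ht1 => ⟨fun j hj => ⟨fun ε hε => ?_, ?_⟩, logCapacity_closedBall ht0,
    area_le_infLemniscateArea_closedBall ht0 ht1,
    exists_logCapacity_eq_infLemniscateArea_ne ht0 ht1⟩, fun h => ?_⟩
  · exact logCapacity_twoIntervals (by linarith) hε
  · obtain ⟨ε, hε, hcap⟩ := exists_logCapacity_twoIntervals_eq (by linarith : 0 < j) ht0
    exact ⟨ε, hε, hcap, fun n hn => minLemniscateArea_twoIntervals_le hj hε hn,
      infLemniscateArea_twoIntervals_le hj hε⟩
  · obtain ⟨K₁, K₂, h₁, h₂, hc₁, hc₂, hne⟩ :=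
      exists_logCapacity_eq_infLemniscateArea_ne (t := 1 / 2) (by norm_num) (by norm_num)
    exact hne (h K₁ K₂ h₁ h₂ (hc₁.trans hc₂.symm))
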